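/- Let $q$ be a complex number with $|q|<1$. Write $(a;q)_n=\prod_{k=0}^{n-1}(1-aq^k)$ for $n\ge 0$ (so $(a;q)_0=1$), $(a;q)_\infty=\prod_{k=0}^{\infty}(1-aq^k)$, and $(a_1,a_2,a_3;q)_\infty=(a_1;q)_\infty(a_2;q)_\infty(a_3;q)_\infty$. Then the series below converges and $$\sum_{n=0}^{\infty}\frac{q^{2n^2+2n}}{(-q;q^2)_n\,(q;q)_{2n+1}}=\frac{(q^8,q^{20},q^{28};q^{28})_\infty+q\,(q^4,q^{24},q^{28};q^{28})_\infty}{(q^2;q^2)_\infty}.$$ -/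

import Mathlib

/-- The finite `q`-shifted factorial `(a; q)_n = ∏_{k=0}^{n-1} (1 - a q^k)`. -/
noncomputable def qPoch (a q : ℂ) (n : ℕ) : ℂ :=
  ∏ k ∈ Finset.range n, (1 - a * q ^ k)

/-- The infinite `q`-shifted factorial `(a; q)_∞ = ∏_{k=0}^{∞} (1 - a q^k)`. -/
noncomputable def qPochInf (a q : ℂ) : ℂ :=
  ∏' k : ℕ, (1 - a * q ^ k)

/-- For `|q| < 1` the infinite product converges, so `qPochInf` is its actual value. -/
theorem hasProd_qPochInf (a q : ℂ) (hq : ‖q‖ < 1) :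
    HasProd (fun k : ℕ => 1 - a * q ^ k) (qPochInf a q) := by
  have hs : Summable (fun k : ℕ => ‖-(a * q ^ k)‖) := by
    simpa [norm_mul, norm_pow] using
      (summable_geometric_of_lt_one (norm_nonneg q) hq).mul_left ‖a‖
  have hm := multipliable_one_add_of_summable hs
  simpa [qPochInf, sub_eq_add_neg] using hm.hasProd

/-! ### Shifted factorials and their reciprocals -/

open Filter Topology

/-! Put `Q = q ^ 2`. Multiplying numerator and denominator by `1 + q^(2n+1)` turns the summand into
`(Q^(n²+n) + q Q^(n²+2n)) / ((Q;Q)_n (Q;Q²)_{n+1})`, so the series is a sum of two Rogers identities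
modulo 14 in base `Q`, the second multiplied by `q`.

In base `q`, the factor `1/((q;q)_n (q;q²)_{n+1})` is a finite alternating sum of `q^(3m²+m) /
((q)_{n-2m} (q)_{n+a+2m})`, for both `a = 1` (`evenSum_eq`) and `a = 2` (`evenSum_one_add_two`).
Summing over `n` first against `q^(n²+an)`, the Durfee rectangle identity gives `q^(2m(2m+a)) /
(q)_∞` for each `m` (`tsum_durfee_shift`). What remains is the theta series with exponent
`7m²+(2a+1)m`, which the Jacobi triple product factors. -/

theorem qPoch_succ (a q : ℂ) (n : ℕ) : qPoch a q (n + 1) = qPoch a q n * (1 - a * q ^ n) := by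
  simp [qPoch, Finset.prod_range_succ]

theorem one_sub_pow_ne_zero {q : ℂ} (hq : ‖q‖ < 1) {n : ℕ} (hn : n ≠ 0) : 1 - q ^ n ≠ 0 := by
  intro h
  have h1 : ‖q ^ n‖ = 1 := by rw [← sub_eq_zero.mp h, norm_one]
  rw [norm_pow] at h1
  exact (pow_lt_one₀ (norm_nonneg q) hq hn).ne h1

theorem one_sub_zpow_ne_zero {q : ℂ} (hq : ‖q‖ < 1) {n : ℤ} (hn : 0 < n) : 1 - q ^ n ≠ 0 := by
  lift n to ℕ using hn.le
  exact_mod_cast one_sub_pow_ne_zero hq (n := n) (by omega)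

theorem qPoch_self_ne_zero {q : ℂ} (hq : ‖q‖ < 1) (n : ℕ) : qPoch q q n ≠ 0 := by
  refine Finset.prod_ne_zero_iff.mpr fun k _ => ?_
  rw [← pow_succ']
  exact one_sub_pow_ne_zero hq k.succ_ne_zero

theorem tendsto_qPoch (a : ℂ) {q : ℂ} (hq : ‖q‖ < 1) :
    Tendsto (qPoch a q) atTop (𝓝 (qPochInf a q)) :=
  (hasProd_qPochInf a q hq).tendsto_prod_nat

theorem qPochInf_self_ne_zero {q : ℂ} (hq : ‖q‖ < 1) : qPochInf q q ≠ 0 := by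
  have hs : Summable (fun k : ℕ => ‖-(q * q ^ k)‖) := by
    simpa [norm_mul, norm_pow] using
      (summable_geometric_of_lt_one (norm_nonneg q) hq).mul_left ‖q‖
  have := tprod_one_add_ne_zero_of_summable (f := fun k : ℕ => -(q * q ^ k)) (fun k => by
    rw [← sub_eq_add_neg, ← pow_succ']
    exact one_sub_pow_ne_zero hq k.succ_ne_zero) hs
  simpa [qPochInf, sub_eq_add_neg] using this

/-- The reciprocal `1 / (q; q)_k`, extended by zero to negative `k`. -/
noncomputable def invPoch (q : ℂ) (k : ℤ) : ℂ :=
  if k < 0 then 0 else (qPoch q q k.toNat)⁻¹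

theorem invPoch_of_neg (q : ℂ) {k : ℤ} (hk : k < 0) : invPoch q k = 0 := if_pos hk

theorem invPoch_natCast (q : ℂ) (n : ℕ) : invPoch q n = (qPoch q q n)⁻¹ := by
  simp [invPoch]

theorem invPoch_zero (q : ℂ) : invPoch q 0 = 1 := by
  simp [invPoch, qPoch]

theorem invPoch_sub_one {q : ℂ} (hq : ‖q‖ < 1) (k : ℤ) :
    invPoch q (k - 1) = (1 - q ^ k) * invPoch q k := by
  rcases lt_trichotomy k 0 with hk | rfl | hk
  · rw [invPoch_of_neg q hk, invPoch_of_neg q (by omega), mul_zero]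
  · rw [invPoch_of_neg q (by omega)]; simp
  · obtain ⟨n, rfl⟩ : ∃ n : ℕ, k = (n : ℤ) + 1 := ⟨(k - 1).toNat, by omega⟩
    have h : invPoch q ((n : ℤ) + 1) = (qPoch q q (n + 1))⁻¹ := by
      exact_mod_cast invPoch_natCast q (n + 1)
    have h2 : q ^ ((n : ℤ) + 1) = q ^ (n + 1) := by exact_mod_cast zpow_natCast q (n + 1)
    rw [add_sub_cancel_right, h, h2, invPoch_natCast, qPoch_succ, ← pow_succ']
    have := one_sub_pow_ne_zero hq n.succ_ne_zero
    have := qPoch_self_ne_zero hq n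
    field_simp

/-- This is `1 - q^(k+l) = (1 - q^k) + q^k (1 - q^l)`. In the bilateral sums below `k + l` does not
depend on the summation index, so the left factor comes out of the sum. -/
theorem invPoch_pascal {q : ℂ} (hq0 : q ≠ 0) (hq : ‖q‖ < 1) (k l : ℤ) :
    (1 - q ^ (k + l)) * (invPoch q k * invPoch q l) =
      invPoch q (k - 1) * invPoch q l + q ^ k * (invPoch q k * invPoch q (l - 1)) := by
  rw [invPoch_sub_one hq, invPoch_sub_one hq, zpow_add₀ hq0]
  ring

theorem tendsto_invPoch {q : ℂ} (hq : ‖q‖ < 1) :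
    Tendsto (fun n : ℕ => invPoch q n) atTop (𝓝 (qPochInf q q)⁻¹) := by
  simp_rw [invPoch_natCast]
  exact (tendsto_qPoch q hq).inv₀ (qPochInf_self_ne_zero hq)

theorem tendsto_invPoch_add {q : ℂ} (hq : ‖q‖ < 1) (m : ℤ) :
    Tendsto (fun n : ℕ => invPoch q (n + m)) atTop (𝓝 (qPochInf q q)⁻¹) := by
  have h : Tendsto (fun n : ℕ => ((n : ℤ) + m).toNat) atTop atTop :=
    tendsto_atTop.mpr fun b => by
      filter_upwards [eventually_ge_atTop (b + m.natAbs)] with n hn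
      omega
  refine ((tendsto_invPoch hq).comp h).congr' ?_
  filter_upwards [eventually_ge_atTop m.natAbs] with n hn
  simp only [Function.comp]
  congr 1
  omega

theorem exists_norm_invPoch_le {q : ℂ} (hq : ‖q‖ < 1) : ∃ C, ∀ k, ‖invPoch q k‖ ≤ C := by
  obtain ⟨C, hC⟩ := (tendsto_invPoch hq).norm.bddAbove_range
  refine ⟨C, fun k => ?_⟩
  have h0 : ∀ n : ℕ, ‖invPoch q n‖ ≤ C := fun n => hC ⟨n, rfl⟩
  rcases lt_or_ge k 0 with hk | hk
  · rw [invPoch_of_neg q hk, norm_zero]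
    exact (norm_nonneg _).trans (h0 0)
  · lift k to ℕ using hk
    exact h0 k

theorem summable_of_forall_abs_gt {f : ℤ → ℂ} (M : ℤ) (h : ∀ m, M < |m| → f m = 0) :
    Summable f :=
  summable_of_ne_finset_zero (s := Finset.Icc (-M) M) fun m hm => h m <| by
    by_contra hc
    exact hm (Finset.mem_Icc.mpr (abs_le.mp (not_lt.mp hc)))

theorem summable_mul_invPoch (q : ℂ) (c : ℤ → ℂ) (i j t : ℤ) (ht : 0 < t) :
    Summable fun m : ℤ => c m * (invPoch q (i - t * m) * invPoch q (j + t * m)) := by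
  refine summable_of_forall_abs_gt (|i| + |j|) fun m hm => ?_
  have hi := le_abs_self i
  have hj := le_abs_self j
  have hi' := abs_nonneg i
  have hj' := abs_nonneg j
  rcases abs_cases m with ⟨h, _⟩ | ⟨h, _⟩
  · rw [invPoch_of_neg q (k := i - t * m) (by nlinarith)]; ring
  · rw [invPoch_of_neg q (k := j + t * m) (by nlinarith)]; ring

/-! ### The Jacobi triple product -/

section TripleProduct

variable {q z : ℂ} {c : ℤ → ℂ}

/-- The finite bilateral sums that interpolate the Jacobi triple product. -/
noncomputable def bilateralSum (q : ℂ) (c : ℤ → ℂ) (i j : ℤ) : ℂ :=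
  ∑' m : ℤ, c m * (invPoch q (i - 1 * m) * invPoch q (j + 1 * m))

/-- The recurrence of `c` absorbs the weight `q^m` of the second Pascal term into `c (m + 1)`; a
shift of index then gives back the first sum. -/
theorem bilateralSum_add_one_right (hq0 : q ≠ 0) (hq : ‖q‖ < 1) (hz : z ≠ 0)
    (hc : ∀ m, c (m + 1) = -z * q ^ m * c m) (n : ℤ) :
    (1 - q ^ (2 * n + 1)) * bilateralSum q c n (n + 1) =
      (1 - q ^ (n + 1) / z) * bilateralSum q c n n := by
  have key : (1 - q ^ (2 * n + 1)) * bilateralSum q c n (n + 1) = bilateralSum q c n n +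
      -(q ^ (n + 1) / z) * ∑' m : ℤ, c (m + 1) *
        (invPoch q (n - 1 * (m + 1)) * invPoch q (n + 1 * (m + 1))) := by
    rw [bilateralSum, bilateralSum, ← tsum_mul_left, ← tsum_mul_left, ← Summable.tsum_add]
    · refine tsum_congr fun m => ?_
      have h := invPoch_pascal hq0 hq (n + 1 + 1 * m) (n - 1 * m)
      rw [show n + 1 + 1 * m + (n - 1 * m) = 2 * n + 1 by ring,
        show n + 1 + 1 * m - 1 = n + 1 * m by ring] at h
      rw [hc, show n - 1 * (m + 1) = n - 1 * m - 1 by ring,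
        show n + 1 * (m + 1) = n + 1 + 1 * m by ring,
        mul_left_comm, mul_comm (invPoch q (n - 1 * m)), h,
        show n + 1 + 1 * m = (n + 1) + m by ring, zpow_add₀ hq0 (n + 1) m]
      field_simp
    · exact summable_mul_invPoch q c n n 1 one_pos
    · exact (((Equiv.addRight (1 : ℤ)).summable_iff.mpr
        (summable_mul_invPoch q c n n 1 one_pos)).mul_left _)
  have shift : ∑' m : ℤ, c (m + 1) * (invPoch q (n - 1 * (m + 1)) *
      invPoch q (n + 1 * (m + 1))) = bilateralSum q c n n :=
    (Equiv.addRight (1 : ℤ)).tsum_eq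
      (fun m => c m * (invPoch q (n - 1 * m) * invPoch q (n + 1 * m)))
  rw [key, shift]
  ring

theorem bilateralSum_add_one (hq0 : q ≠ 0) (hq : ‖q‖ < 1)
    (hc : ∀ m, c (m + 1) = -z * q ^ m * c m) (n : ℤ) :
    (1 - q ^ (2 * n + 2)) * bilateralSum q c (n + 1) (n + 1) =
      (1 - z * q ^ n) * bilateralSum q c n (n + 1) := by
  have key : (1 - q ^ (2 * n + 2)) * bilateralSum q c (n + 1) (n + 1) =
      bilateralSum q c n (n + 1) + -(z * q ^ n) * ∑' m : ℤ, c (m - 1) *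
        (invPoch q (n - 1 * (m - 1)) * invPoch q (n + 1 + 1 * (m - 1))) := by
    rw [bilateralSum, bilateralSum, ← tsum_mul_left, ← tsum_mul_left, ← Summable.tsum_add]
    · refine tsum_congr fun m => ?_
      have h := invPoch_pascal hq0 hq (n + 1 - 1 * m) (n + 1 + 1 * m)
      have hcm := hc (m - 1)
      rw [sub_add_cancel] at hcm
      rw [show n + 1 - 1 * m + (n + 1 + 1 * m) = 2 * n + 2 by ring,
        show n + 1 - 1 * m - 1 = n - 1 * m by ring,
        show n + 1 + 1 * m - 1 = n + 1 * m by ring] at h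
      have hp : q ^ (n + 1 - 1 * m) * q ^ (m - 1) = q ^ n := by
        rw [← zpow_add₀ hq0]; congr 1; ring
      rw [show n - 1 * (m - 1) = n + 1 - 1 * m by ring,
        show n + 1 + 1 * (m - 1) = n + 1 * m by ring,
        mul_left_comm, h, hcm, ← hp]
      ring
    · exact summable_mul_invPoch q c n (n + 1) 1 one_pos
    · exact (((Equiv.subRight (1 : ℤ)).summable_iff.mpr
        (summable_mul_invPoch q c n (n + 1) 1 one_pos)).mul_left _)
  have shift : ∑' m : ℤ, c (m - 1) * (invPoch q (n - 1 * (m - 1)) *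
      invPoch q (n + 1 + 1 * (m - 1))) = bilateralSum q c n (n + 1) :=
    (Equiv.subRight (1 : ℤ)).tsum_eq
      (fun m => c m * (invPoch q (n - 1 * m) * invPoch q (n + 1 + 1 * m)))
  rw [key, shift]
  ring

theorem bilateralSum_zero (q : ℂ) (c : ℤ → ℂ) : bilateralSum q c 0 0 = c 0 := by
  rw [bilateralSum, tsum_eq_single 0]
  · simp [invPoch_zero]
  · intro m hm
    rcases lt_or_gt_of_ne hm with h | h
    · rw [invPoch_of_neg q (k := 0 + 1 * m) (by omega)]; ring
    · rw [invPoch_of_neg q (k := 0 - 1 * m) (by omega)]; ring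

/-- Finite form of the triple product, obtained by alternating the two one-sided steps. -/
theorem bilateralSum_eq (hq0 : q ≠ 0) (hq : ‖q‖ < 1) (hz : z ≠ 0)
    (hc : ∀ m, c (m + 1) = -z * q ^ m * c m) (n : ℕ) :
    bilateralSum q c n n = c 0 * qPoch z q n * qPoch (q / z) q n * invPoch q (2 * n : ℕ) := by
  induction n with
  | zero => simpa [qPoch, invPoch_zero] using bilateralSum_zero q c
  | succ n ih =>
    have h1 := bilateralSum_add_one_right hq0 hq hz hc n
    have h2 := bilateralSum_add_one hq0 hq hc n
    have e1 : q ^ (2 * (n : ℤ) + 1) = q ^ (2 * n + 1) := by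
      exact_mod_cast zpow_natCast q (2 * n + 1)
    have e2 : q ^ (2 * (n : ℤ) + 2) = q ^ (2 * n + 2) := by
      exact_mod_cast zpow_natCast q (2 * n + 2)
    have e3 : q ^ ((n : ℤ) + 1) = q ^ (n + 1) := by exact_mod_cast zpow_natCast q (n + 1)
    rw [e1, e3] at h1
    rw [e2, zpow_natCast] at h2
    have n1 := one_sub_pow_ne_zero hq (n := 2 * n + 1) (by omega)
    have n2 := one_sub_pow_ne_zero hq (n := 2 * n + 2) (by omega)
    have n3 := qPoch_self_ne_zero hq (2 * n)
    have e4 : invPoch q (2 * (n + 1) : ℕ) * ((1 - q ^ (2 * n + 1)) * (1 - q ^ (2 * n + 2))) =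
        invPoch q (2 * n : ℕ) := by
      rw [invPoch_natCast, invPoch_natCast, show 2 * (n + 1) = 2 * n + 1 + 1 by ring, qPoch_succ,
        qPoch_succ, ← pow_succ', ← pow_succ']
      field_simp
    apply mul_left_cancel₀ (mul_ne_zero n1 n2)
    rw [qPoch_succ, qPoch_succ]
    rw [ih] at h1
    push_cast at *
    calc _ = (1 - q ^ (2 * n + 1)) * ((1 - q ^ (2 * n + 2)) *
          bilateralSum q c ((n : ℤ) + 1) ((n : ℤ) + 1)) := by ring
      _ = (1 - z * q ^ n) * ((1 - q ^ (2 * n + 1)) * bilateralSum q c n (n + 1)) := by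
        rw [h2]; ring
      _ = _ := by rw [h1, ← e4]; ring

/-- The Jacobi triple product, for a coefficient sequence given by its recurrence. -/
theorem tsum_eq_triple_product (hq0 : q ≠ 0) (hq : ‖q‖ < 1) (hz : z ≠ 0)
    (hc : ∀ m, c (m + 1) = -z * q ^ m * c m) (hs : Summable fun m => ‖c m‖) :
    ∑' m, c m = c 0 * qPochInf z q * qPochInf (q / z) q * qPochInf q q := by
  obtain ⟨C, hC⟩ := exists_norm_invPoch_le hq
  have hC0 : 0 ≤ C := (norm_nonneg _).trans (hC 0)
  -- Termwise both reciprocals tend to `1/(q)_∞`; their uniform bound gives domination.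
  have h1 : Tendsto (fun n : ℕ => bilateralSum q c n n) atTop
      (𝓝 (∑' m, c m * ((qPochInf q q)⁻¹ * (qPochInf q q)⁻¹))) := by
    refine tendsto_tsum_of_dominated_convergence (bound := fun m => ‖c m‖ * (C * C))
      (hs.mul_right _) (fun m => ?_) (Eventually.of_forall fun n m => ?_)
    · refine tendsto_const_nhds.mul (Tendsto.mul ?_ ?_)
      · simpa [sub_eq_add_neg] using tendsto_invPoch_add hq (-m)
      · simpa using tendsto_invPoch_add hq m
    · rw [norm_mul, norm_mul]
      gcongr <;> exact hC _
  have h2 : Tendsto (fun n : ℕ => bilateralSum q c n n) atTop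
      (𝓝 (c 0 * qPochInf z q * qPochInf (q / z) q * (qPochInf q q)⁻¹)) := by
    simp_rw [bilateralSum_eq hq0 hq hz hc]
    refine ((tendsto_const_nhds.mul (tendsto_qPoch z hq)).mul (tendsto_qPoch _ hq)).mul ?_
    exact (tendsto_invPoch hq).comp (tendsto_id.const_mul_atTop' two_pos)
  have h := tendsto_nhds_unique h1 h2
  rw [tsum_mul_right] at h
  have h0 := qPochInf_self_ne_zero hq
  field_simp at h
  linear_combination h

end TripleProduct

/-! ### Bailey pairs with `β_n = 1 / ((q; q)_n (q; q²)_{n+1})` -/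

section BaileyPair

variable {q : ℂ}

/-- The coefficients `(-1)^m q^{k m² + e m}`. -/
noncomputable def signedGauss (q : ℂ) (k e m : ℤ) : ℂ :=
  (-1) ^ m * q ^ (k * m ^ 2 + e * m)

/-- The bilateral sum `∑ (-1)^m q^{3m² + em} / ((q)_{i-2m} (q)_{j+2m})`. -/
noncomputable def evenSum (q : ℂ) (e i j : ℤ) : ℂ :=
  ∑' m : ℤ, signedGauss q 3 e m * (invPoch q (i - 2 * m) * invPoch q (j + 2 * m))

theorem summable_evenSum (q : ℂ) (e i j : ℤ) : Summable fun m : ℤ =>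
    signedGauss q 3 e m * (invPoch q (i - 2 * m) * invPoch q (j + 2 * m)) :=
  summable_mul_invPoch q _ i j 2 two_pos

/-- The Pascal weight `q^(j+2m)` raises the linear exponent `e` by 2. -/
theorem evenSum_pascal_right (hq0 : q ≠ 0) (hq : ‖q‖ < 1) (e i j : ℤ) :
    (1 - q ^ (i + j)) * evenSum q e i j =
      evenSum q e i (j - 1) + q ^ j * evenSum q (e + 2) (i - 1) j := by
  rw [evenSum, evenSum, evenSum, ← tsum_mul_left, ← tsum_mul_left, ← Summable.tsum_add
    (summable_evenSum q _ _ _) ((summable_evenSum q _ _ _).mul_left _)]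
  refine tsum_congr fun m => ?_
  have h := invPoch_pascal hq0 hq (j + 2 * m) (i - 2 * m)
  rw [show j + 2 * m + (i - 2 * m) = i + j by ring] at h
  have hp : q ^ j * signedGauss q 3 (e + 2) m = signedGauss q 3 e m * q ^ (j + 2 * m) := by
    rw [signedGauss, signedGauss, mul_left_comm, mul_assoc, ← zpow_add₀ hq0, ← zpow_add₀ hq0]
    congr 2; ring
  rw [← mul_assoc (q ^ j), hp, mul_left_comm, mul_comm (invPoch q (i - 2 * m)), h,
    show j - 1 + 2 * m = j + 2 * m - 1 by ring, show i - 1 - 2 * m = i - 2 * m - 1 by ring]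
  ring

theorem evenSum_neg (q : ℂ) (e i j : ℤ) : evenSum q (-e) j i = evenSum q e i j := by
  rw [evenSum, evenSum, ← (Equiv.neg ℤ).tsum_eq]
  refine tsum_congr fun m => ?_
  simp only [Equiv.neg_apply, signedGauss, zpow_neg, ← inv_zpow, inv_neg, inv_one]
  rw [show 3 * (-m) ^ 2 + -e * -m = 3 * m ^ 2 + e * m by ring,
    show j - 2 * -m = j + 2 * m by ring, show i + 2 * -m = i - 2 * m by ring,
    mul_comm (invPoch q (j + 2 * m))]

theorem evenSum_pascal_left (hq0 : q ≠ 0) (hq : ‖q‖ < 1) (e i j : ℤ) :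
    (1 - q ^ (i + j)) * evenSum q e i j =
      evenSum q e (i - 1) j + q ^ i * evenSum q (e - 2) i (j - 1) := by
  have h := evenSum_pascal_right hq0 hq (-e) j i
  rw [show -e + 2 = -(e - 2) by ring, evenSum_neg, evenSum_neg, evenSum_neg, add_comm j] at h
  exact h

/-- The reflection `m ↦ -1 - m` fixes `3m² + 3m` and flips the sign `(-1)^m`. Hence `e = 3` gives
the vanishing sums that close the recurrences for `e = 1`. -/
theorem evenSum_three_reflect (q : ℂ) (i j : ℤ) :
    evenSum q 3 (j - 2) (i + 2) = -evenSum q 3 i j := by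
  rw [evenSum, evenSum, ← tsum_neg, ← (Equiv.subLeft (-1 : ℤ)).tsum_eq]
  refine tsum_congr fun m => ?_
  simp only [Equiv.subLeft_apply, signedGauss]
  rw [zpow_sub₀ (by norm_num), zpow_neg_one, div_eq_mul_inv, ← inv_zpow, inv_neg, inv_one,
    show 3 * (-1 - m) ^ 2 + 3 * (-1 - m) = 3 * m ^ 2 + 3 * m by ring,
    show j - 2 - 2 * (-1 - m) = j + 2 * m by ring, show i + 2 + 2 * (-1 - m) = i - 2 * m by ring]
  ring

theorem evenSum_three_self (q : ℂ) (i : ℤ) : evenSum q 3 i (i + 2) = 0 := by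
  have h := evenSum_three_reflect q i (i + 2)
  rw [add_sub_cancel_right] at h
  linear_combination h / 2

theorem evenSum_one_succ (hq0 : q ≠ 0) (hq : ‖q‖ < 1) (n : ℤ) :
    (1 - q ^ (2 * n + 1)) * evenSum q 1 n (n + 1) = evenSum q 1 n n := by
  have h := evenSum_pascal_right hq0 hq 1 n (n + 1)
  have h3 := evenSum_three_self q (n - 1)
  rw [show n - 1 + 2 = n + 1 by ring] at h3
  rw [show n + (n + 1) = 2 * n + 1 by ring, add_sub_cancel_right, show (1 : ℤ) + 2 = 3 by rfl,
    h3] at h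
  simpa using h

theorem evenSum_three_succ (hq0 : q ≠ 0) (hq : ‖q‖ < 1) (n : ℤ) :
    (1 - q ^ (2 * n + 1)) * evenSum q 3 n (n + 1) = q ^ n * evenSum q 1 n n := by
  have h := evenSum_pascal_left hq0 hq 3 n (n + 1)
  have h3 := evenSum_three_self q (n - 1)
  rw [show n - 1 + 2 = n + 1 by ring] at h3
  rw [show n + (n + 1) = 2 * n + 1 by ring, add_sub_cancel_right, show (3 : ℤ) - 2 = 1 by rfl,
    h3, zero_add] at h
  exact h

theorem evenSum_one_succ_succ (hq0 : q ≠ 0) (hq : ‖q‖ < 1) (n : ℤ) :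
    (1 - q ^ (2 * n + 2)) * evenSum q 1 (n + 1) (n + 1) =
      (1 + q ^ (n + 1)) * evenSum q 1 n (n + 1) := by
  have h := evenSum_pascal_left hq0 hq 1 (n + 1) (n + 1)
  rw [show n + 1 + (n + 1) = 2 * n + 2 by ring, add_sub_cancel_right,
    show (1 : ℤ) - 2 = -1 by rfl, evenSum_neg] at h
  rw [h]; ring

/-- Pascal leaves an `e = 3` sum that reflects to `-q^n` times the right side, so the factor `1 -
q^(2n+2)` appears on both sides. -/
theorem evenSum_one_add_two (hq0 : q ≠ 0) (hq : ‖q‖ < 1) {n : ℤ} (hn : 0 ≤ n) :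
    evenSum q 1 n (n + 2) = evenSum q 1 n (n + 1) := by
  have h := evenSum_pascal_right hq0 hq 1 n (n + 2)
  have h3 := evenSum_three_reflect q n (n + 1)
  have h4 := evenSum_three_succ hq0 hq n
  rw [← evenSum_one_succ hq0 hq] at h4
  have n1 := one_sub_zpow_ne_zero hq (n := 2 * n + 1) (by omega)
  have n2 := one_sub_zpow_ne_zero hq (n := 2 * n + 2) (by omega)
  have h5 : evenSum q 3 n (n + 1) = q ^ n * evenSum q 1 n (n + 1) :=
    mul_left_cancel₀ n1 (by rw [h4]; ring)
  rw [show n + 1 - 2 = n - 1 by ring, h5] at h3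
  rw [show n + (n + 2) = 2 * n + 2 by ring, show n + 2 - 1 = n + 1 by ring,
    show (1 : ℤ) + 2 = 3 by rfl, h3] at h
  have hp : q ^ (n + 2) * q ^ n = q ^ (2 * n + 2) := by
    rw [← zpow_add₀ hq0]; congr 1; ring
  refine mul_left_cancel₀ n2 ?_
  rw [h, ← hp]; ring

theorem evenSum_one_zero (q : ℂ) : evenSum q 1 0 0 = 1 := by
  rw [evenSum, tsum_eq_single 0]
  · simp [invPoch_zero, signedGauss]
  · intro m hm
    rcases lt_or_gt_of_ne hm with h | h
    · rw [invPoch_of_neg q (k := 0 + 2 * m) (by omega)]; ring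
    · rw [invPoch_of_neg q (k := 0 - 2 * m) (by omega)]; ring

theorem qPoch_odd_ne_zero (hq : ‖q‖ < 1) (n : ℕ) : qPoch q (q ^ 2) n ≠ 0 := by
  refine Finset.prod_ne_zero_iff.mpr fun k _ => ?_
  rw [← pow_mul, ← pow_succ']
  exact one_sub_pow_ne_zero hq (Nat.succ_ne_zero _)

theorem evenSum_eq (hq0 : q ≠ 0) (hq : ‖q‖ < 1) (n : ℕ) :
    evenSum q 1 n (n + 1) = (qPoch q q n * qPoch q (q ^ 2) (n + 1))⁻¹ := by
  refine eq_inv_of_mul_eq_one_left ?_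
  induction n with
  | zero =>
    have h := evenSum_one_succ hq0 hq 0
    rw [evenSum_one_zero] at h
    simp [qPoch] at h ⊢
    rw [mul_comm]; exact h
  | succ n ih =>
    have h1 := evenSum_one_succ hq0 hq (n + 1 : ℕ)
    have h2 := evenSum_one_succ_succ hq0 hq n
    have e1 : q ^ (2 * ((n + 1 : ℕ) : ℤ) + 1) = q ^ (2 * n + 3) := by
      exact_mod_cast zpow_natCast q (2 * n + 3)
    have e2 : q ^ (2 * (n : ℤ) + 2) = q ^ (2 * n + 2) := by
      exact_mod_cast zpow_natCast q (2 * n + 2)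
    have e3 : q ^ ((n : ℤ) + 1) = q ^ (n + 1) := by exact_mod_cast zpow_natCast q (n + 1)
    rw [e1] at h1
    rw [e2, e3] at h2
    rw [qPoch_succ q (q ^ 2) (n + 1), qPoch_succ q q n]
    have n1 : 1 + q ^ (n + 1) ≠ 0 := fun h => by
      refine one_sub_pow_ne_zero hq (n := 2 * n + 2) (by omega) ?_
      rw [show 1 - q ^ (2 * n + 2) = (1 - q ^ (n + 1)) * (1 + q ^ (n + 1)) by ring, h, mul_zero]
    refine mul_left_cancel₀ n1 ?_
    calc _ = ((1 - q ^ (2 * n + 3)) * evenSum q 1 (n + 1 : ℕ) ((n + 1 : ℕ) + 1)) *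
          (1 - q ^ (2 * n + 2)) * (qPoch q q n * qPoch q (q ^ 2) (n + 1)) := by ring
      _ = ((1 - q ^ (2 * n + 2)) * evenSum q 1 (n + 1) (n + 1)) *
          (qPoch q q n * qPoch q (q ^ 2) (n + 1)) := by rw [h1]; push_cast; ring
      _ = _ := by rw [h2, mul_assoc, ih]

end BaileyPair

/-! ### The limiting Bailey lemma -/

section BaileyLemma

variable {q : ℂ}

theorem summable_norm_pow {q : ℂ} (hq : ‖q‖ < 1) {e : ℕ → ℕ} (he : ∀ n, n ≤ e n) :
    Summable fun n => ‖q‖ ^ e n :=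
  Summable.of_nonneg_of_le (fun _ => by positivity)
    (fun n => pow_le_pow_of_le_one (norm_nonneg q) hq.le (he n))
    (summable_geometric_of_lt_one (norm_nonneg q) hq)

theorem summable_norm_zpow (hq0 : q ≠ 0) (hq : ‖q‖ < 1) {e : ℤ → ℤ} (he : ∀ m, |m| ≤ e m) :
    Summable fun m => ‖q‖ ^ e m := by
  have hg := summable_geometric_of_lt_one (norm_nonneg q) hq
  have h0 : Summable fun m : ℤ => ‖q‖ ^ |m| :=
    Summable.of_nat_of_neg (by simpa using hg) (by simpa using hg)
  refine Summable.of_nonneg_of_le (fun _ => by positivity) (fun m => ?_) h0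
  exact zpow_le_zpow_right_of_le_one₀ (norm_pos_iff.mpr hq0) hq.le (he m)

theorem norm_signedGauss (q : ℂ) (k e m : ℤ) :
    ‖signedGauss q k e m‖ = ‖q‖ ^ (k * m ^ 2 + e * m) := by
  simp [signedGauss]

/-- The summand of the Durfee rectangle series `∑ q^{n² + nd} / ((q)_n (q)_{n+d})`. -/
noncomputable def durfeeTerm (q : ℂ) (d n : ℕ) : ℂ :=
  q ^ (n ^ 2 + n * d) * (invPoch q n * invPoch q (n + d))

theorem norm_durfeeTerm_le {C : ℝ} (hC : ∀ k, ‖invPoch q k‖ ≤ C) (d n : ℕ) :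
    ‖durfeeTerm q d n‖ ≤ ‖q‖ ^ (n ^ 2 + n * d) * (C * C) := by
  have hC0 : 0 ≤ C := (norm_nonneg _).trans (hC 0)
  rw [durfeeTerm, norm_mul, norm_mul, norm_pow]
  gcongr <;> exact hC _

theorem summable_durfeeTerm (hq : ‖q‖ < 1) (d : ℕ) : Summable (durfeeTerm q d) := by
  obtain ⟨C, hC⟩ := exists_norm_invPoch_le hq
  exact Summable.of_norm_bounded ((summable_norm_pow hq (e := fun n => n ^ 2 + n * d)
    fun n => by nlinarith).mul_right _) (norm_durfeeTerm_le hC d)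

/-- The difference of the two summands telescopes through `H`, and `H 0 = 0` because `1/(q)_{-1} =
0`. -/
theorem tsum_durfeeTerm_succ (hq : ‖q‖ < 1) (d : ℕ) :
    ∑' n, durfeeTerm q d n = ∑' n, durfeeTerm q (d + 1) n := by
  set H : ℕ → ℂ := fun n =>
    q ^ (n ^ 2 + n * d) * (invPoch q ((n : ℤ) - 1) * invPoch q (n + d)) with hH
  have hH0 : H 0 = 0 := by simp [hH, invPoch_of_neg]
  have hstep : ∀ n, durfeeTerm q d n - durfeeTerm q (d + 1) n = H n - H (n + 1) := by
    intro n
    have e1 := invPoch_sub_one hq n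
    have e2 := invPoch_sub_one hq (n + (d + 1 : ℕ))
    have e3 : q ^ ((n : ℤ) + (d + 1 : ℕ)) = q ^ (n + d + 1) := by
      exact_mod_cast zpow_natCast q (n + d + 1)
    rw [zpow_natCast] at e1
    rw [e3, show (n : ℤ) + (d + 1 : ℕ) - 1 = n + d by push_cast; ring] at e2
    simp only [hH, durfeeTerm]
    rw [show ((n + 1 : ℕ) : ℤ) - 1 = n by push_cast; ring,
      show ((n + 1 : ℕ) : ℤ) + d = n + (d + 1 : ℕ) by push_cast; ring, e1, e2]
    ring
  obtain ⟨C, hC⟩ := exists_norm_invPoch_le hq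
  have hC0 : 0 ≤ C := (norm_nonneg _).trans (hC 0)
  have hHs : Summable H := by
    refine Summable.of_norm_bounded ((summable_norm_pow hq (e := fun n => n ^ 2 + n * d)
      fun n => by nlinarith).mul_right (C * C)) fun n => ?_
    rw [hH, norm_mul, norm_mul, norm_pow]
    gcongr <;> exact hC _
  have h := hHs.tsum_eq_zero_add
  rw [← sub_eq_zero, ← (summable_durfeeTerm hq d).tsum_sub (summable_durfeeTerm hq (d + 1)),
    tsum_congr hstep, hHs.tsum_sub ((summable_nat_add_iff 1).mpr hHs), h, hH0]
  ring

/-- The sum does not depend on `d`; as `d → ∞` only the term `n = 0` survives. -/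
theorem tsum_durfeeTerm (hq : ‖q‖ < 1) (d : ℕ) :
    ∑' n, durfeeTerm q d n = (qPochInf q q)⁻¹ := by
  obtain ⟨C, hC⟩ := exists_norm_invPoch_le hq
  have hC0 : 0 ≤ C := (norm_nonneg _).trans (hC 0)
  have hconst : ∀ d, ∑' n, durfeeTerm q d n = ∑' n, durfeeTerm q 0 n := fun d => by
    induction d with
    | zero => rfl
    | succ d ih => rw [← tsum_durfeeTerm_succ hq, ih]
  have hlim : Tendsto (fun d => ∑' n, durfeeTerm q d n) atTop
      (𝓝 (∑' n : ℕ, if n = 0 then (qPochInf q q)⁻¹ else 0)) := by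
    refine tendsto_tsum_of_dominated_convergence (bound := fun n => ‖q‖ ^ (n ^ 2) * (C * C))
      ((summable_norm_pow hq fun n => by nlinarith).mul_right _) (fun n => ?_)
      (Eventually.of_forall fun d n => ?_)
    · rcases eq_or_ne n 0 with rfl | hn
      · simpa [durfeeTerm, invPoch_zero] using tendsto_invPoch hq
      · rw [if_neg hn]
        refine squeeze_zero_norm (fun d => (norm_durfeeTerm_le hC d n).trans ?_)
          (a := fun d => ‖q‖ ^ d * (C * C)) ?_
        · gcongr ?_ * _
          exact pow_le_pow_of_le_one (norm_nonneg q) hq.le (by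
            have := Nat.one_le_iff_ne_zero.mpr hn
            nlinarith)
        · simpa using (tendsto_pow_atTop_nhds_zero_of_lt_one (norm_nonneg q) hq).mul_const (C * C)
    · refine (norm_durfeeTerm_le hC d n).trans ?_
      gcongr ?_ * _
      exact pow_le_pow_of_le_one (norm_nonneg q) hq.le (by omega)
  rw [tsum_ite_eq] at hlim
  rw [hconst d]
  exact tendsto_nhds_unique (by simp_rw [hconst]; exact tendsto_const_nhds) hlim

theorem tsum_durfee_shift_of_nonneg (hq : ‖q‖ < 1) (a r : ℕ) :
    ∑' n : ℕ, q ^ (n ^ 2 + a * n) * (invPoch q (n - r) * invPoch q (n + r + a)) =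
      q ^ ((r : ℤ) * (r + a)) * (qPochInf q q)⁻¹ := by
  have hz : ∀ n ∉ Set.range fun k : ℕ => k + r,
      q ^ (n ^ 2 + a * n) * (invPoch q ((n : ℤ) - r) * invPoch q (n + r + a)) = 0 := by
    intro n hn
    have : n < r := by
      by_contra hc
      exact hn ⟨n - r, by simp; omega⟩
    rw [invPoch_of_neg q (by omega)]; ring
  rw [← (add_left_injective r).tsum_eq (Function.support_subset_iff'.mpr hz),
    ← tsum_durfeeTerm hq (2 * r + a), ← tsum_mul_left]
  refine tsum_congr fun k => ?_
  have e : q ^ ((r : ℤ) * (r + a)) = q ^ (r * (r + a)) := by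
    exact_mod_cast zpow_natCast q (r * (r + a))
  rw [e, durfeeTerm]
  push_cast
  rw [show (k : ℤ) + r - r = k by ring, show (k : ℤ) + r + r + a = k + (2 * r + a) by ring]
  ring

/-- The substitution `r ↦ -(r + a)` swaps the two reciprocals, reducing the second case to the
first. -/
theorem tsum_durfee_shift (hq : ‖q‖ < 1) (a : ℕ) {r : ℤ}
    (hr : 0 ≤ r ∨ r + a ≤ 0) :
    ∑' n : ℕ, q ^ (n ^ 2 + a * n) * (invPoch q (n - r) * invPoch q (n + r + a)) =
      q ^ (r * (r + a)) * (qPochInf q q)⁻¹ := by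
  rcases hr with hr | hr
  · lift r to ℕ using hr
    exact tsum_durfee_shift_of_nonneg hq a r
  · obtain ⟨s, rfl⟩ : ∃ s : ℕ, r = -(s + a : ℤ) := ⟨(-(r + a)).toNat, by omega⟩
    rw [show -(s + a : ℤ) * (-(s + a : ℤ) + a) = s * (s + a) by ring,
      ← tsum_durfee_shift_of_nonneg hq a s]
    refine tsum_congr fun n => ?_
    rw [show (n : ℤ) - -(s + a) = n + s + a by ring,
      show (n : ℤ) + -(s + a) + a = n - s by ring]
    ring

/-- The summand of the double series behind the limiting Bailey lemma. -/
noncomputable def baileyTerm (q : ℂ) (a : ℕ) (p : ℕ × ℤ) : ℂ :=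
  q ^ (p.1 ^ 2 + a * p.1) * (signedGauss q 3 1 p.2 *
    (invPoch q (p.1 - 2 * p.2) * invPoch q (p.1 + a + 2 * p.2)))

theorem summable_baileyTerm (hq0 : q ≠ 0) (hq : ‖q‖ < 1) (a : ℕ) :
    Summable (baileyTerm q a) := by
  obtain ⟨C, hC⟩ := exists_norm_invPoch_le hq
  have hC0 : 0 ≤ C := (norm_nonneg _).trans (hC 0)
  have h1 : Summable fun n : ℕ => ‖q‖ ^ (n ^ 2 + a * n) :=
    summable_norm_pow hq fun n => by nlinarith
  have h2 : Summable fun m : ℤ => ‖q‖ ^ (3 * m ^ 2 + 1 * m) :=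
    summable_norm_zpow hq0 hq fun m => by
      rw [abs_le']
      constructor
      · nlinarith [sq_nonneg m]
      · rcases le_or_gt 0 m with h | h <;> nlinarith
  refine Summable.of_norm_bounded ((h1.mul_of_nonneg h2 (fun _ => by positivity)
    (fun _ => by positivity)).mul_right (C * C)) fun p => ?_
  rw [baileyTerm, norm_mul, norm_mul, norm_mul, norm_signedGauss, norm_pow, mul_assoc]
  gcongr <;> exact hC _

theorem tsum_baileyTerm (hq0 : q ≠ 0) (hq : ‖q‖ < 1) {a : ℕ} (ha : a ≤ 2) :
    ∑' p, baileyTerm q a p =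
      (∑' m, signedGauss q 7 (2 * a + 1) m) * (qPochInf q q)⁻¹ := by
  have hs : Summable fun p : ℤ × ℕ => baileyTerm q a (p.2, p.1) :=
    (Equiv.prodComm ℤ ℕ).summable_iff.mpr (summable_baileyTerm hq0 hq a)
  have hswap : ∑' p : ℤ × ℕ, baileyTerm q a (p.2, p.1) = ∑' p, baileyTerm q a p :=
    (Equiv.prodComm ℤ ℕ).tsum_eq (baileyTerm q a)
  rw [← hswap, hs.tsum_prod, ← tsum_mul_right]
  refine tsum_congr fun m => ?_
  -- Here `a ≤ 2` matters: a negative `m` has `2m ≤ -2`.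
  have hr : 0 ≤ 2 * m ∨ 2 * m + (a : ℤ) ≤ 0 := by omega
  have hd := tsum_durfee_shift hq a hr
  have hg : signedGauss q 7 (2 * a + 1) m =
      signedGauss q 3 1 m * q ^ (2 * m * (2 * m + (a : ℤ))) := by
    rw [signedGauss, signedGauss, mul_assoc, ← zpow_add₀ hq0]
    congr 2; ring
  rw [hg, mul_assoc, ← hd, ← tsum_mul_left]
  refine tsum_congr fun n => ?_
  rw [baileyTerm, show (n : ℤ) + a + 2 * m = n + 2 * m + a by ring]
  ring

theorem hasSum_evenSum (hq0 : q ≠ 0) (hq : ‖q‖ < 1) {a : ℕ} (ha : a ≤ 2) :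
    HasSum (fun n : ℕ => q ^ (n ^ 2 + a * n) * evenSum q 1 n (n + a))
      ((∑' m, signedGauss q 7 (2 * a + 1) m) * (qPochInf q q)⁻¹) := by
  rw [← tsum_baileyTerm hq0 hq ha]
  have h : ∀ n : ℕ, HasSum (fun m : ℤ => baileyTerm q a (n, m))
      (q ^ (n ^ 2 + a * n) * evenSum q 1 n (n + a)) := fun n => by
    simp only [baileyTerm]
    rw [evenSum]
    exact (summable_evenSum q 1 n (n + a)).hasSum.mul_left (q ^ (n ^ 2 + a * n))
  exact (summable_baileyTerm hq0 hq a).hasSum.prod_fiberwise h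

end BaileyLemma

/-! ### The Rogers identities modulo 14 -/

section Rogers

variable {q : ℂ}

/-- Triple product in base `q^14` with `z = q^(7+e)`; the bound on `e` gives `7m² + em ≥ |m|`, hence
summability. -/
theorem tsum_signedGauss_seven (hq0 : q ≠ 0) (hq : ‖q‖ < 1) {e : ℤ} (he : |e| ≤ 6) :
    ∑' m, signedGauss q 7 e m = qPochInf (q ^ (7 + e)) (q ^ 14) *
      qPochInf (q ^ (7 - e)) (q ^ 14) * qPochInf (q ^ 14) (q ^ 14) := by
  have hq14 : ‖q ^ 14‖ < 1 := by
    rw [norm_pow]; exact pow_lt_one₀ (norm_nonneg q) hq (by norm_num)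
  have hdiv : q ^ 14 / q ^ (7 + e) = q ^ (7 - e) := by
    rw [← zpow_natCast, ← zpow_sub₀ hq0]; congr 1; push_cast; ring
  rw [tsum_eq_triple_product (q := q ^ 14) (z := q ^ (7 + e)) (pow_ne_zero _ hq0) hq14
    (zpow_ne_zero _ hq0) _ _, hdiv]
  · simp [signedGauss]
  · intro m
    rw [signedGauss, signedGauss, zpow_add_one₀ (by norm_num), ← zpow_natCast, ← zpow_mul,
      show 7 * (m + 1) ^ 2 + e * (m + 1) = (7 + e) + (14 : ℕ) * m + (7 * m ^ 2 + e * m) by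
        push_cast; ring, zpow_add₀ hq0, zpow_add₀ hq0]
    ring
  · simp_rw [norm_signedGauss]
    refine summable_norm_zpow hq0 hq fun m => ?_
    have h := abs_le.mp he
    have hm : |m| ≤ m ^ 2 := by
      rw [← sq_abs]; nlinarith [abs_nonneg m, Int.one_le_abs (z := m), eq_or_ne m 0,
        show |m| = 0 ∨ 1 ≤ |m| by have := abs_nonneg m; omega]
    have h2 : -(6 * |m|) ≤ e * m := by
      have := abs_mul e m
      have h3 := neg_abs_le (e * m)
      nlinarith [abs_nonneg m]
    nlinarith

theorem hasSum_rogers (hq0 : q ≠ 0) (hq : ‖q‖ < 1) :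
    HasSum (fun n : ℕ => q ^ (n ^ 2 + n) / (qPoch q q n * qPoch q (q ^ 2) (n + 1)))
      (qPochInf (q ^ 10) (q ^ 14) * qPochInf (q ^ 4) (q ^ 14) * qPochInf (q ^ 14) (q ^ 14) /
        qPochInf q q) := by
  have h := hasSum_evenSum hq0 hq (a := 1) (by norm_num)
  rw [tsum_signedGauss_seven hq0 hq (by norm_num), ← div_eq_mul_inv] at h
  push_cast at h
  simp_rw [evenSum_eq hq0 hq, ← div_eq_mul_inv, one_mul] at h
  exact_mod_cast h

theorem hasSum_rogers_shifted (hq0 : q ≠ 0) (hq : ‖q‖ < 1) :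
    HasSum (fun n : ℕ => q ^ (n ^ 2 + 2 * n) / (qPoch q q n * qPoch q (q ^ 2) (n + 1)))
      (qPochInf (q ^ 12) (q ^ 14) * qPochInf (q ^ 2) (q ^ 14) * qPochInf (q ^ 14) (q ^ 14) /
        qPochInf q q) := by
  have h := hasSum_evenSum hq0 hq (a := 2) le_rfl
  rw [tsum_signedGauss_seven hq0 hq (by norm_num), ← div_eq_mul_inv] at h
  push_cast at h
  simp_rw [evenSum_one_add_two hq0 hq (Int.natCast_nonneg _), evenSum_eq hq0 hq,
    ← div_eq_mul_inv] at h
  exact_mod_cast h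

end Rogers

/-! ### Reduction of the series to the Rogers identities -/

theorem qPoch_self_odd (q : ℂ) (n : ℕ) :
    qPoch q q (2 * n + 1) = qPoch q (q ^ 2) (n + 1) * qPoch (q ^ 2) (q ^ 2) n := by
  induction n with
  | zero => simp [qPoch]
  | succ n ih =>
    rw [show 2 * (n + 1) + 1 = 2 * n + 1 + 1 + 1 by ring, qPoch_succ, qPoch_succ, ih,
      qPoch_succ q (q ^ 2) (n + 1), qPoch_succ (q ^ 2) (q ^ 2) n]
    ring

theorem qPoch_neg_mul_qPoch (a q : ℂ) (n : ℕ) :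
    qPoch (-a) q n * qPoch a q n = qPoch (a ^ 2) (q ^ 2) n := by
  rw [qPoch, qPoch, qPoch, ← Finset.prod_mul_distrib]
  exact Finset.prod_congr rfl fun k _ => by ring

theorem mainTheorem3 (q : ℂ) (hq : ‖q‖ < 1) :
    HasSum
      (fun n : ℕ =>
        q ^ (2 * n ^ 2 + 2 * n) / (qPoch (-q) (q ^ 2) n * qPoch q q (2 * n + 1)))
      ((qPochInf (q ^ 8) (q ^ 28) * qPochInf (q ^ 20) (q ^ 28) * qPochInf (q ^ 28) (q ^ 28)
          + q * (qPochInf (q ^ 4) (q ^ 28) * qPochInf (q ^ 24) (q ^ 28)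
            * qPochInf (q ^ 28) (q ^ 28)))
        / qPochInf (q ^ 2) (q ^ 2)) := by
  -- The integer powers above need `q ≠ 0`; at `q = 0` only the term `n = 0` remains.
  rcases eq_or_ne q 0 with rfl | hq0
  · convert hasSum_ite_eq (0 : ℕ) (1 : ℂ) using 1
    · ext n
      rcases eq_or_ne n 0 with rfl | hn
      · simp [qPoch]
      · simp [hn]
    · simp [qPochInf]
  have hQ0 : q ^ 2 ≠ 0 := pow_ne_zero _ hq0
  have hQ : ‖q ^ 2‖ < 1 := by
    rw [norm_pow]; exact pow_lt_one₀ (norm_nonneg q) hq two_ne_zero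
  have h := (hasSum_rogers hQ0 hQ).add ((hasSum_rogers_shifted hQ0 hQ).mul_left q)
  simp only [← pow_mul, Nat.reduceMul] at h
  convert h using 1
  · ext n
    -- `(-q;q²)_{n+1} (q;q²)_{n+1} = (q²;q⁴)_{n+1}`; its extra factor `1 + q^(2n+1)` accounts for
    -- the two series.
    have h2 := qPoch_neg_mul_qPoch q (q ^ 2) (n + 1)
    rw [qPoch_succ, ← pow_mul q 2 2] at h2
    have n1 := qPoch_self_ne_zero hQ n
    have n2 := qPoch_odd_ne_zero hQ (n + 1)
    rw [← pow_mul q 2 2] at n2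
    have n3 : qPoch (-q) (q ^ 2) n * (1 - -q * (q ^ 2) ^ n) * qPoch q (q ^ 2) (n + 1) ≠ 0 := by
      rw [h2]; exact n2
    have n4 := right_ne_zero_of_mul n3
    have n5 := left_ne_zero_of_mul (left_ne_zero_of_mul n3)
    simp only [Nat.reduceMul] at h2
    rw [← mul_div_assoc, ← add_div, qPoch_self_odd, ← h2, div_eq_div_iff
      (mul_ne_zero n5 (mul_ne_zero n4 n1)) (mul_ne_zero n1 n3)]
    ring
  · ring
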